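/- A packing integer program (PIP) with $n$ bidders, $K$ options and $m$ constraints is given by non-negative reals $A_{\ell,i,k}$ and $c_\ell$. Its feasible outcomes are the $x\in\{0,1\}^{n\times K}$ with $\sum_k x_{i,k}\le 1$ for every bidder $i$ and $\sum_{i,k}A_{\ell,i,k}x_{i,k}\le c_\ell$ for every constraint $\ell$. A valuation of bidder $i$ is a vector $v_i\in\mathbb{R}_{\ge 0}^K$, with $v_i(x)=\sum_k v_{i,k}x_{i,k}$; the welfare of $x$ is $\sum_i v_i(x)$, and $OPT(v)$ is the maximum welfare over the feasible outcomes. The column sparsity is $\max_{i,k}|\{\ell : A_{\ell,i,k}\ne 0\}|$. The canonical LP relaxation replaces $x_{i,k}\in\{0,1\}$ by $x_{i,k}\ge 0$, where, as usual, variables with $A_{\ell,i,k}>c_\ell$ for some $\ell$ (which are $0$ in every feasible outcome) are first fixed to $0$. An oblivious rounding scheme maps each solution $x'$ of the relaxation to a random feasible outcome $x$, without access to the objective; it is $\alpha$-approximate if $\mathbf{E}[w(x)]\ge w(x')/\alpha$ for all $x'$ and all $w(x)=\sum_{i,k}w_{i,k}x_{i,k}$ with $w\ge 0$. Combined with a rule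 that selects, for each bid profile $b\in(\mathbb{R}_{\ge 0}^{K})^n$, a solution $x'$ of the relaxation maximizing $\sum_i b_i(x')$, it gives the following pay-your-bid mechanism: choose $x'$ for $b$, round it to $f(b)$, and charge each bidder $i$ the payment $b_i(f(b))$. Bidders have quasi-linear expected utilities $\mathbf{E}[v_i(f(b))-b_i(f(b))]$. The Price of Anarchy with respect to mixed Nash equilibria is the supremum, over all $v$ and all mixed Nash equilibria $b$ for $v$ (independently randomized bids), of $OPT(v)/\mathbf{E}[\sum_i v_i(f(b))]$. With respect to mixed Bayes-Nash equilibria it is the supremum, over all independent priors on the valuations and all mixed Bayes-Nash equilibria (in which the bid of each bidder is randomized depending on the bidder's own valuation), of $\mathbf{E}[OPT(v)]/\mathbf{E}[\sum_i v_i(f(b))]$; here $0/0$ is read as $0$. **Theorem.** Let $d\ge 1$. For every packing integer program of column sparsity at most $d$ the canonical LP relaxation admits a (measurable) exact declared-welfare maximizer, and there is an $8d$-approximate oblivious rounding scheme such that, for every (measurable) exact declared-welfare maximizer, the resulting pay-your-bid mechanism has Price of Anarchy at most $16d(d+1)$, with respect to both mixed Nash equilibria and mixed Bayes-Nash equilibria.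 In particular the bound is $32$ for $d=1$. -/

import Mathlib

open MeasureTheory ProbabilityTheory
open scoped NNReal ENNReal

noncomputable section

/-- The type of valuations (and of bids) of one bidder: a non-negative value for each option. -/
abbrev PIPValuation (K : ℕ) : Type := Fin K → ℝ≥0

/-- Value of the (possibly fractional) assignment `y` of options for a bidder with valuation `t`. -/
def pipValue {K : ℕ} (t : PIPValuation K) (y : Fin K → ℝ≥0) : ℝ≥0 := ∑ k, t k * y k

/-- Total value `∑ i, v i (x i)` of an allocation `x` for the profile `v`. -/
def pipWelfare {n K : ℕ} (v : Fin n → PIPValuation K) (x : Fin n → Fin K → ℝ≥0) : ℝ≥0 :=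
  ∑ i, pipValue (v i) (x i)

/-- A packing integer program with `n` bidders, `K` options for each of them, and `m` packing
constraints `∑ i, ∑ k, A l i k * x i k ≤ c l` with non-negative data. -/
structure PIP (n K m : ℕ) where
  A : Fin m → Fin n → Fin K → ℝ≥0
  c : Fin m → ℝ≥0

namespace PIP

variable {n K m : ℕ}

open Classical in
/-- The maximum number of non-zero entries in a column of `A`. -/
def columnSparsity (I : PIP n K m) : ℕ :=
  Finset.univ.sup fun i : Fin n => Finset.univ.sup fun k : Fin K =>
    (Finset.univ.filter fun l : Fin m => I.A l i k ≠ 0).card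

/-- Every bidder gets at most one option, and the packing constraints hold. -/
def IsFeasible (I : PIP n K m) (x : Fin n → Fin K → ℝ≥0) : Prop :=
  (∀ i, ∑ k, x i k ≤ 1) ∧ ∀ l, ∑ i, ∑ k, I.A l i k * x i k ≤ I.c l

/-- The variable `x i k` fits: on its own it can be set to `1`. -/
def Fits (I : PIP n K m) (i : Fin n) (k : Fin K) : Prop := ∀ l, I.A l i k ≤ I.c l

/-- The `0/1` vector `x` as a vector of non-negative reals. -/
def ofBinary (x : Fin n → Fin K → Fin 2) : Fin n → Fin K → ℝ≥0 := fun i k => ((x i k : ℕ) : ℝ≥0)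

/-- The outcomes: feasible binary allocations. -/
def Outcome (I : PIP n K m) : Type := {x : Fin n → Fin K → Fin 2 // I.IsFeasible (ofBinary x)}

instance (I : PIP n K m) : Finite I.Outcome := by
  unfold Outcome; infer_instance

instance (I : PIP n K m) : Fintype I.Outcome := Fintype.ofFinite _

/-- The allocation of an outcome, with entries in `ℝ≥0`. -/
def Outcome.alloc {I : PIP n K m} (x : I.Outcome) : Fin n → Fin K → ℝ≥0 := ofBinary x.1

/-- The canonical LP relaxation: `x i k ∈ {0, 1}` is replaced by `0 ≤ x i k`. A variable that does
not fit is `0` in every integral solution and is removed from the program beforehand; if all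
variables fit, nothing is removed (see `isRelaxed_iff_of_fits`). -/
def IsRelaxed (I : PIP n K m) (x : Fin n → Fin K → ℝ≥0) : Prop :=
  I.IsFeasible x ∧ ∀ i k, ¬ I.Fits i k → x i k = 0

theorem isRelaxed_iff_of_fits (I : PIP n K m) (h : ∀ i k, I.Fits i k)
    (x : Fin n → Fin K → ℝ≥0) : I.IsRelaxed x ↔ I.IsFeasible x :=
  ⟨fun hx => hx.1, fun hx => ⟨hx, fun i k hik => absurd (h i k) hik⟩⟩

/-- The relaxation contains all outcomes of the integer program. -/
theorem isRelaxed_alloc {I : PIP n K m} (x : I.Outcome) : I.IsRelaxed x.alloc := by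
  refine ⟨x.2, fun i k hik => ?_⟩
  by_contra hne
  refine hik fun l => ?_
  have h1 : x.alloc i k = 1 := by
    unfold Outcome.alloc ofBinary at hne ⊢
    have : ((x.1 i k : Fin 2) : ℕ) < 2 := (x.1 i k).2
    have h0 : ((x.1 i k : Fin 2) : ℕ) ≠ 0 := fun h => hne (by rw [h]; simp)
    have : ((x.1 i k : Fin 2) : ℕ) = 1 := by omega
    rw [this]; simp
  calc I.A l i k = I.A l i k * x.alloc i k := by rw [h1, mul_one]
    _ ≤ ∑ k', I.A l i k' * x.alloc i k' :=
        Finset.single_le_sum (f := fun k' => I.A l i k' * x.alloc i k')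
          (fun _ _ => zero_le) (Finset.mem_univ k)
    _ ≤ ∑ i', ∑ k', I.A l i' k' * x.alloc i' k' :=
        Finset.single_le_sum (f := fun i' => ∑ k', I.A l i' k' * x.alloc i' k')
          (fun _ _ => zero_le) (Finset.mem_univ i)
    _ ≤ I.c l := x.2.2 l

/-- The solutions of the LP relaxation. -/
abbrev LPSolution (I : PIP n K m) : Type := {x : Fin n → Fin K → ℝ≥0 // I.IsRelaxed x}

/-- The optimal social welfare `max_x ∑ i, v i (x i)` over all outcomes. -/
def opt (I : PIP n K m) (v : Fin n → PIPValuation K) : ℝ≥0 :=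
  Finset.univ.sup fun x : I.Outcome => pipWelfare v x.alloc

/-- A randomized rounding scheme: it sees a solution of the relaxation only, not the objective. -/
structure ObliviousRounding (I : PIP n K m) where
  round : I.LPSolution → PMF I.Outcome
  measurable_round : ∀ x, Measurable fun y => round y x

/-- For every relaxed solution `y` and every objective `w`, the expected weight of the rounded
solution is at least `w y / α`. -/
def ObliviousRounding.IsApprox {I : PIP n K m} (R : I.ObliviousRounding) (α : ℝ≥0∞) : Prop :=
  ∀ (y : I.LPSolution) (w : Fin n → PIPValuation K),
    (pipWelfare w y.1 : ℝ≥0∞) / α ≤ ∑ x, R.round y x * (pipWelfare w x.alloc : ℝ≥0∞)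

/-- An exact declared welfare maximizer for the LP relaxation (with any rule to break ties). -/
structure LPSolver (I : PIP n K m) where
  solve : (Fin n → PIPValuation K) → I.LPSolution
  measurable_solve : Measurable solve
  optimal : ∀ b (y : I.LPSolution), pipWelfare b y.1 ≤ pipWelfare b (solve b).1

/-- A direct pay-your-bid mechanism with a randomized outcome rule. On the outcome `x`, bidder `i`
pays the declared value `b i (x i)`. -/
structure PayYourBid (I : PIP n K m) where
  outcome : (Fin n → PIPValuation K) → PMF I.Outcome
  measurable_outcome : ∀ x, Measurable fun b => outcome b x

/-- Solve the relaxation for the declared valuations, then round. -/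
def relaxAndRound {I : PIP n K m} (S : I.LPSolver) (R : I.ObliviousRounding) : I.PayYourBid where
  outcome b := R.round (S.solve b)
  measurable_outcome x := (R.measurable_round x).comp S.measurable_solve

namespace PayYourBid

variable {I : PIP n K m}

/-- Payment of bidder `i` under bids `b` in outcome `x`. -/
def payment (_M : I.PayYourBid) (b : Fin n → PIPValuation K) (i : Fin n) (x : I.Outcome) : ℝ≥0 :=
  pipValue (b i) (x.alloc i)

/-- Expected quasi-linear utility, over the randomness of the mechanism, of bidder `i` with
valuation `t` under the bid profile `b`. -/
def utility (M : I.PayYourBid) (i : Fin n) (b : Fin n → PIPValuation K) (t : PIPValuation K) : ℝ :=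
  ∑ x, (M.outcome b x).toReal * ((pipValue t (x.alloc i) : ℝ) - (M.payment b i x : ℝ))

/-- Expected social welfare, over the randomness of the mechanism, under the bid profile `b`. -/
def welfare (M : I.PayYourBid) (v b : Fin n → PIPValuation K) : ℝ≥0∞ :=
  ∑ x, M.outcome b x * (pipWelfare v x.alloc : ℝ≥0∞)

/-- `σ` is a mixed Nash equilibrium for the valuations `v`: the bidders draw their bids
independently, bidder `i` from `σ i`, and no bidder gains in expectation by a unilateral deviation.
Valuations are fixed and payments are non-negative, so that integrability says that the expected
utilities are not `-∞`. By linearity it is enough to consider deterministic deviations. -/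
structure IsMixedNash (M : I.PayYourBid) (v : Fin n → PIPValuation K)
    (σ : Fin n → Measure (PIPValuation K)) : Prop where
  isProbabilityMeasure : ∀ i, IsProbabilityMeasure (σ i)
  integrable : ∀ i, Integrable (fun b => M.utility i b (v i)) (Measure.pi σ)
  no_deviation : ∀ i, ∀ b' : PIPValuation K,
    ∫ b, M.utility i (Function.update b i b') (v i) ∂Measure.pi σ ≤
      ∫ b, M.utility i b (v i) ∂Measure.pi σ

/-- The Price of Anarchy with respect to mixed Nash equilibria (in `ℝ≥0∞`, where `0 / 0 = 0` and
`a / 0 = ∞` for `a ≠ 0`). -/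
def priceOfAnarchy (M : I.PayYourBid) : ℝ≥0∞ :=
  ⨆ (v : Fin n → PIPValuation K) (σ : Fin n → Measure (PIPValuation K))
    (_ : M.IsMixedNash v σ), (I.opt v : ℝ≥0∞) / ∫⁻ b, M.welfare v b ∂Measure.pi σ

/-- The joint law of valuations (first components) and bids (second components) if the valuations
are drawn independently, that of bidder `i` from `D i`, and bidder `i` with valuation `t` draws the
bid from `s i t`. -/
def jointLaw (D : Fin n → Measure (PIPValuation K))
    (s : Fin n → Kernel (PIPValuation K) (PIPValuation K)) :
    Measure (Fin n → PIPValuation K × PIPValuation K) :=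
  Measure.pi fun i => D i ⊗ₘ s i

/-- `s` is a mixed Bayes-Nash equilibrium for the independent priors `D`: for (almost) every
valuation `t` of bidder `i`, given `t` and in expectation over the valuations of the others and
all bids, no deviation to another bid `b'` is profitable. The prior `Function.update D i (dirac t)`
expresses conditioning on the valuation of bidder `i` being `t`. -/
structure IsMixedBayesNash (M : I.PayYourBid) (D : Fin n → Measure (PIPValuation K))
    (s : Fin n → Kernel (PIPValuation K) (PIPValuation K)) : Prop where
  isProbabilityMeasure : ∀ i, IsProbabilityMeasure (D i)
  isMarkovKernel : ∀ i, IsMarkovKernel (s i)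
  integrable : ∀ i, ∀ᵐ t ∂D i,
    Integrable (fun z => M.utility i (fun j => (z j).2) t)
      (jointLaw (Function.update D i (Measure.dirac t)) s)
  no_deviation : ∀ i, ∀ᵐ t ∂D i, ∀ b' : PIPValuation K,
    ∫ z, M.utility i (Function.update (fun j => (z j).2) i b') t
        ∂jointLaw (Function.update D i (Measure.dirac t)) s ≤
      ∫ z, M.utility i (fun j => (z j).2) t
        ∂jointLaw (Function.update D i (Measure.dirac t)) s

/-- The Price of Anarchy with respect to mixed Bayes-Nash equilibria: the worst ratio of the
expected optimal welfare and the expected welfare in equilibrium. -/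
def bayesPriceOfAnarchy (M : I.PayYourBid) : ℝ≥0∞ :=
  ⨆ (D : Fin n → Measure (PIPValuation K))
    (s : Fin n → Kernel (PIPValuation K) (PIPValuation K)) (_ : M.IsMixedBayesNash D s),
    (∫⁻ v, (I.opt v : ℝ≥0∞) ∂Measure.pi D) /
      ∫⁻ z, M.welfare (fun j => (z j).1) (fun j => (z j).2) ∂jointLaw D s

end PayYourBid

end PIP

end

/-!
The proof combines three facts.

*Solving the relaxation.* The relaxation is a polytope with finitely many extreme points, because an
extreme point is determined by the inequalities that are tight at it
(`finite_extremePoints_polyhedron`), and every objective is maximized at one of them. Taking the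
first optimal one in a fixed enumeration gives a measurable solver (`PIP.nonempty_lpSolver`).

*Rounding.* From a relaxed solution `y`, every bidder independently makes a tentative choice, option
`k` with probability `y i k / (4 * d)`. A choice is dropped if in some constraint that it uses it is
big (above half of the capacity) and another bidder chose a big option, or it is not big and the
others use more than half of the capacity. What survives is feasible
(`PIP.isFeasible_alteration`). In both cases a dropped choice meets a constraint of which the others
use at least half, while their expected use is at most a `1 / (4 * d)` fraction. By Markov's
inequality and a union bound over the at most `d` constraints involved, a choice survives with
conditional probability at least `1 / 2`, so `x i k = 1` with probability at least `y i k / (8 * d)`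
(`PIP.div_le_prob_kept`).

*Smoothness.* Let `y` be optimal for the bids `b`, let `z` be any relaxed solution, and let bidder
`i` deviate to the bid `β i`. A competing solution gives bidder `i` the assignment of `z` and, in
each constraint, takes the capacity needed for it from the other bidders by scaling down their part
of `y`. As the shares of the bidders in a constraint add up to at most `1` and a variable uses at
most `d` constraints, the losses of all these exchanges add up to at most `d` times `b y`, and
another `b y` accounts for bidder `i` leaving `y`: the deviators together obtain at least
`β z - (d + 1) * b y` (`PIP.LPSolver.smooth`). Oblivious rounding transfers this to the mechanism
with a loss of `α = 8 * d` (`PIP.PayYourBid.opt_le_of_isApprox`).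

With `β i` half of the valuation, a deviation that depends on the own valuation only, the utility
from deviating equals the deviator's declared value. In equilibrium, deviation values plus payments
are thus at most the welfare, and `OPT / (2 * α)` is at most the deviation values plus `d + 1` times
the payments, hence at most `d + 1` times the welfare. Since the deviation needs no knowledge of the
other valuations, the argument applies given each bidder's valuation, and integrating over it
(`PIP.PayYourBid.lintegral_jointLaw`) gives the Bayesian bound. After the best-response step all
expectations are integrals in `ℝ≥0∞`, so infinite expected values need no separate treatment.
-/

noncomputable section

/-! ### Measurable optimization over the relaxation -/

/-- An extreme point of a polyhedron is determined by its set of tight inequalities: otherwise it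
could be moved in both directions along the line through another point with the same tight
inequalities. -/
theorem finite_extremePoints_polyhedron {E J : Type*} [AddCommGroup E] [Module ℝ E] [Finite J]
    (f : J → E →ₗ[ℝ] ℝ) (a : J → ℝ) : (Set.extremePoints ℝ {x | ∀ j, f j x ≤ a j}).Finite := by
  refine Set.Finite.of_finite_image (f := fun x => {j | f j x = a j}) (Set.toFinite _) ?_
  intro x hx y hy hxy
  rw [mem_extremePoints] at hx
  have hyP : ∀ j, f j y ≤ a j := hy.1
  have htight : ∀ j, f j x = a j → f j y = a j := fun j hj => by
    have : j ∈ {j | f j x = a j} := hj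
    rw [show {j | f j x = a j} = {j | f j y = a j} from hxy] at this
    exact this
  have hev : ∀ j, ∀ᶠ ε : ℝ in nhdsWithin 0 (Set.Ioi 0), f j (x + ε • (x - y)) ≤ a j := by
    intro j
    by_cases hj : f j x = a j
    · filter_upwards with ε
      simp [hj, htight j hj]
    · have hlt : f j x < a j := lt_of_le_of_ne (hx.1 j) hj
      have hc : Filter.Tendsto (fun ε : ℝ => f j x + ε * (f j x - f j y))
          (nhdsWithin 0 (Set.Ioi 0)) (nhds (f j x + 0 * (f j x - f j y))) :=
        ((by fun_prop : Continuous fun ε : ℝ => f j x + ε * (f j x - f j y)).tendsto 0).mono_left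
          nhdsWithin_le_nhds
      rw [zero_mul, add_zero] at hc
      filter_upwards [hc.eventually_lt_const hlt] with ε hε
      simpa using hε.le
  obtain ⟨ε, hε, hpos⟩ :=
    ((Filter.eventually_all.2 hev).and self_mem_nhdsWithin).exists
  have hpos : (0 : ℝ) < ε := hpos
  refine ((hx.2 _ hε y hyP ⟨1 / (1 + ε), ε / (1 + ε), by positivity, by positivity,
    by field_simp, ?_⟩).2).symm
  have h1 : (1 + ε) ≠ 0 := by positivity
  have : x = (1 / (1 + ε)) • ((1 + ε) • x) := by rw [smul_smul]; field_simp; simp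
  rw [smul_sub, div_eq_inv_mul ε, mul_smul, ← one_div, ← smul_add]
  conv_rhs => rw [this]
  congr 1
  rw [add_smul, one_smul]; abel

/-- A continuous linear functional attains its maximum over a non-empty compact set at an extreme
point. -/
theorem exists_extremePoint_isMaxOn {E : Type*} [AddCommGroup E] [Module ℝ E] [TopologicalSpace E]
    [T2Space E] [IsTopologicalAddGroup E] [ContinuousSMul ℝ E] [LocallyConvexSpace ℝ E]
    {s : Set E} (hs : IsCompact s) (hne : s.Nonempty) (g : StrongDual ℝ E) :
    ∃ x ∈ s.extremePoints ℝ, ∀ y ∈ s, g y ≤ g x := by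
  have hexp : IsExposed ℝ s (g.toExposed s) := ContinuousLinearMap.toExposed.isExposed
  obtain ⟨x, hx, hmax⟩ := hs.exists_isMaxOn hne g.continuous.continuousOn
  have hcomp : IsCompact (g.toExposed s) := hexp.isCompact hs
  obtain ⟨z, hz⟩ := hcomp.extremePoints_nonempty (⟨x, hx, fun y hy => hmax hy⟩)
  exact ⟨z, hexp.isExtreme.extremePoints_subset_extremePoints hz, hz.1.2⟩

namespace PIP

variable {n K m : ℕ}

/-- The variable `x i k` as a linear functional. -/
def coordinate (i : Fin n) (k : Fin K) : (Fin n → Fin K → ℝ) →ₗ[ℝ] ℝ :=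
  (LinearMap.proj k : (Fin K → ℝ) →ₗ[ℝ] ℝ).comp (LinearMap.proj i)

@[simp]
theorem coordinate_apply (i : Fin n) (k : Fin K) (x : Fin n → Fin K → ℝ) :
    coordinate i k x = x i k := rfl

/-- The constraints of the LP relaxation over the reals, in the form `f j x ≤ a j`: non-negativity,
at most one option for each bidder, packing, and `x i k ≤ 0` if `x i k` does not fit. -/
theorem exists_linear_description (I : PIP n K m) :
    ∃ (J : Type) (_ : Finite J) (f : J → (Fin n → Fin K → ℝ) →ₗ[ℝ] ℝ) (a : J → ℝ),
      ∀ x, (∀ j, f j x ≤ a j) ↔ (∀ i k, 0 ≤ x i k) ∧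
        I.IsRelaxed fun i k => (x i k).toNNReal := by
  classical
  refine ⟨(Fin n × Fin K) ⊕ Fin n ⊕ Fin m ⊕ {p : Fin n × Fin K // ¬ I.Fits p.1 p.2},
    inferInstance,
    Sum.elim (fun p => -coordinate p.1 p.2) (Sum.elim (fun i => ∑ k, coordinate i k)
      (Sum.elim (fun l => ∑ i, ∑ k, (I.A l i k : ℝ) • coordinate i k)
        (fun p => coordinate p.1.1 p.1.2))),
    Sum.elim (fun _ => 0) (Sum.elim (fun _ => 1)
      (Sum.elim (fun l => (I.c l : ℝ)) (fun _ => 0))), fun x => ?_⟩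
  simp only [Sum.forall, Sum.elim_inl, Sum.elim_inr, LinearMap.neg_apply, LinearMap.sum_apply,
    LinearMap.smul_apply, coordinate_apply, Prod.forall,
    Subtype.forall, Left.neg_nonpos_iff, smul_eq_mul, IsRelaxed, IsFeasible, and_assoc]
  refine and_congr_right fun h0 => and_congr ?_ (and_congr ?_ ?_)
  · refine forall_congr' fun i => ?_
    rw [← NNReal.coe_le_coe]
    simp [Real.coe_toNNReal _ (h0 _ _)]
  · refine forall_congr' fun i => ?_
    rw [← NNReal.coe_le_coe]
    simp [Real.coe_toNNReal _ (h0 _ _)]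
  · simp [Real.toNNReal_eq_zero]

/-- The solutions of the LP relaxation over the reals. -/
def realPolytope (I : PIP n K m) : Set (Fin n → Fin K → ℝ) :=
  {x | (∀ i k, 0 ≤ x i k) ∧ I.IsRelaxed fun i k => (x i k).toNNReal}

theorem finite_extremePoints_realPolytope (I : PIP n K m) :
    (I.realPolytope.extremePoints ℝ).Finite := by
  obtain ⟨J, _, f, a, h⟩ := I.exists_linear_description
  rw [show I.realPolytope = {x | ∀ j, f j x ≤ a j} from Set.ext fun x => (h x).symm]
  exact finite_extremePoints_polyhedron f a

theorem isCompact_realPolytope (I : PIP n K m) : IsCompact I.realPolytope := by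
  obtain ⟨J, _, f, a, h⟩ := I.exists_linear_description
  have hclosed : IsClosed I.realPolytope := by
    rw [show I.realPolytope = ⋂ j, {x | f j x ≤ a j} from
      Set.ext fun x => by rw [Set.mem_iInter]; exact (h x).symm]
    exact isClosed_iInter fun j =>
      isClosed_le (f j).continuous_of_finiteDimensional continuous_const
  refine (isCompact_univ_pi fun _ => isCompact_univ_pi fun _ => isCompact_Icc).of_isClosed_subset
    (s := Set.univ.pi fun _ => Set.univ.pi fun _ => Set.Icc (0 : ℝ) 1) hclosed fun x hx => ?_
  simp only [Set.mem_pi, Set.mem_univ, forall_const, Set.mem_Icc]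
  intro i k
  refine ⟨hx.1 i k, Real.toNNReal_le_one.1 ?_⟩
  exact (Finset.single_le_sum (f := fun k => (x i k).toNNReal) (fun _ _ => zero_le)
    (Finset.mem_univ k)).trans (hx.2.1.1 i)

theorem isRelaxed_zero (I : PIP n K m) : I.IsRelaxed 0 := by
  refine ⟨⟨fun i => ?_, fun l => ?_⟩, fun _ _ _ => rfl⟩ <;> simp

theorem pipWelfare_coe (b : Fin n → PIPValuation K) (x : Fin n → Fin K → ℝ)
    (hx : ∀ i k, 0 ≤ x i k) :
    (pipWelfare b (fun i k => (x i k).toNNReal) : ℝ) = ∑ i, ∑ k, (b i k : ℝ) * x i k := by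
  simp [pipWelfare, pipValue, Real.coe_toNNReal _ (hx _ _)]

/-- For every objective, some extreme point of the relaxation is optimal. -/
theorem exists_extremePoint_optimal (I : PIP n K m) (b : Fin n → PIPValuation K) :
    ∃ x ∈ I.realPolytope.extremePoints ℝ, ∀ y : I.LPSolution,
      pipWelfare b y.1 ≤ pipWelfare b fun i k => (x i k).toNNReal := by
  let g : (Fin n → Fin K → ℝ) →ₗ[ℝ] ℝ :=
    ∑ i, ∑ k, (b i k : ℝ) • coordinate i k
  have hg : ∀ x, g x = ∑ i, ∑ k, (b i k : ℝ) * x i k := fun x => by simp [g]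
  obtain ⟨x, hx, hmax⟩ := exists_extremePoint_isMaxOn I.isCompact_realPolytope
    ⟨0, fun _ _ => le_rfl,
      by simpa only [Pi.zero_apply, Real.toNNReal_zero] using! I.isRelaxed_zero⟩
    (LinearMap.toContinuousLinearMap g)
  refine ⟨x, hx, fun y => ?_⟩
  have hy := hmax (fun i k => (y.1 i k : ℝ)) ⟨fun _ _ => NNReal.coe_nonneg _, by simpa using y.2⟩
  rw [LinearMap.coe_toContinuousLinearMap', hg, hg, ← pipWelfare_coe b _ hx.1.1,
    ← pipWelfare_coe b _ (fun _ _ => NNReal.coe_nonneg _)] at hy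
  simpa using hy

/-- Finitely many solutions of the relaxation suffice for all objectives, so the first optimal one
in a fixed enumeration is a measurable choice. -/
theorem nonempty_lpSolver (I : PIP n K m) : Nonempty I.LPSolver := by
  classical
  have hcount : (I.realPolytope.extremePoints ℝ).Countable :=
    I.finite_extremePoints_realPolytope.countable
  obtain ⟨x₀, hx₀, -⟩ := I.exists_extremePoint_optimal 0
  obtain ⟨e, he⟩ := hcount.exists_eq_range ⟨x₀, hx₀⟩
  have heP : ∀ N, e N ∈ I.realPolytope := fun N =>
    (he ▸ Set.mem_range_self N : e N ∈ I.realPolytope.extremePoints ℝ).1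
  let g : ℕ → I.LPSolution := fun N => ⟨fun i k => (e N i k).toNNReal, (heP N).2⟩
  have hex : ∀ b : Fin n → PIPValuation K, ∃ N, ∀ y : I.LPSolution,
      pipWelfare b y.1 ≤ pipWelfare b (g N).1 := fun b => by
    obtain ⟨x, hx, hmax⟩ := I.exists_extremePoint_optimal b
    rw [he] at hx
    obtain ⟨N, rfl⟩ := hx
    exact ⟨N, hmax⟩
  have hcont : ∀ y : Fin n → Fin K → ℝ≥0,
      Continuous fun b : Fin n → PIPValuation K => pipWelfare b y := fun y => by
    unfold pipWelfare pipValue; fun_prop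
  refine ⟨⟨fun b => g (Nat.find (hex b)), ?_, fun b => Nat.find_spec (hex b)⟩⟩
  refine (measurable_from_nat (f := g)).comp (measurable_find hex fun N => ?_)
  rw [Set.ofPred_forall]
  exact (isClosed_iInter fun y => isClosed_le (hcont _) (hcont _)).measurableSet

end PIP

/-! ### Randomized rounding with alteration -/

section ProductWeights

variable {ι α R : Type*} [Fintype ι] [DecidableEq ι] [Fintype α] [CommSemiring R]

theorem sum_prod_mul_prod (p F : ι → α → R) :
    ∑ ω : ι → α, (∏ i, p i (ω i)) * ∏ i, F i (ω i) = ∏ i, ∑ a, p i a * F i a := by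
  rw [Finset.prod_univ_sum]
  simp [Finset.prod_mul_distrib]

theorem sum_prod_eq_one (p : ι → α → R) (hp : ∀ i, ∑ a, p i a = 1) :
    ∑ ω : ι → α, ∏ i, p i (ω i) = 1 := by
  simpa [hp] using sum_prod_mul_prod p fun _ _ => 1

/-- The expectation of a function of one coordinate under a product distribution. -/
theorem sum_prod_mul_apply (p : ι → α → R) (hp : ∀ i, ∑ a, p i a = 1) (i : ι) (f : α → R) :
    ∑ ω : ι → α, (∏ i, p i (ω i)) * f (ω i) = ∑ a, p i a * f a := by
  have h := sum_prod_mul_prod p fun i' => if i' = i then f else 1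
  have h1 : ∀ ω : ι → α, ∏ i', (if i' = i then f else 1) (ω i') = f (ω i) := fun ω => by
    rw [Finset.prod_eq_single i] <;> simp +contextual
  rw [Finset.prod_eq_single i (by simp +contextual [hp]) (by simp)] at h
  simpa [h1] using h

/-- Distinct coordinates are uncorrelated under a product distribution. -/
theorem sum_prod_mul_apply_mul_apply (p : ι → α → R) (hp : ∀ i, ∑ a, p i a = 1) {i j : ι}
    (hij : i ≠ j) (f g : α → R) :
    ∑ ω : ι → α, (∏ i, p i (ω i)) * (f (ω i) * g (ω j)) =
      (∑ a, p i a * f a) * ∑ a, p j a * g a := by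
  have h := sum_prod_mul_prod p fun i' => if i' = i then f else if i' = j then g else 1
  have h1 : ∀ ω : ι → α, ∏ i', (if i' = i then f else if i' = j then g else 1) (ω i') =
      f (ω i) * g (ω j) := fun ω => by
    rw [Finset.prod_eq_mul i j hij] <;> simp +contextual [hij.symm]
  rw [Finset.prod_eq_mul i j hij (by simp +contextual [hp]) (by simp) (by simp)] at h
  simpa [h1, hij.symm] using h

end ProductWeights

namespace PIP

variable {n K m : ℕ}

/-- The use of constraint `l` by bidder `i` if the bidder's tentative choice is `o`. -/
def load (I : PIP n K m) (l : Fin m) (i : Fin n) (o : Option (Fin K)) : ℝ≥0 := o.elim 0 (I.A l i)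

/-- Option `k` is big for bidder `i` in constraint `l` if it needs more than half of the capacity.
-/
def IsBig (I : PIP n K m) (l : Fin m) (i : Fin n) (k : Fin K) : Prop := I.c l < 2 * I.A l i k

/-- The tentative choice `k` of bidder `i` survives the alteration step: in every constraint that
it uses, no other bidder chose a big option if `k` is big, and the others use at most half of the
capacity if `k` is not big. -/
def Kept (I : PIP n K m) (ω : Fin n → Option (Fin K)) (i : Fin n) (k : Fin K) : Prop :=
  ω i = some k ∧ I.Fits i k ∧ ∀ l, I.A l i k ≠ 0 →
    (I.IsBig l i k → ∀ j ≠ i, ∀ k', ω j = some k' → ¬ I.IsBig l j k') ∧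
    (¬ I.IsBig l i k → 2 * ∑ j ∈ Finset.univ.erase i, I.load l j (ω j) ≤ I.c l)

open Classical in
/-- The allocation made of the surviving choices. -/
def alteration (I : PIP n K m) (ω : Fin n → Option (Fin K)) (i : Fin n) (k : Fin K) : Fin 2 :=
  if I.Kept ω i k then 1 else 0

open Classical in
theorem ofBinary_alteration (I : PIP n K m) (ω : Fin n → Option (Fin K)) (i : Fin n) (k : Fin K) :
    ofBinary (I.alteration ω) i k = if I.Kept ω i k then 1 else 0 := by
  unfold ofBinary alteration
  split_ifs <;> simp

theorem ofBinary_alteration_le (I : PIP n K m) (ω : Fin n → Option (Fin K)) (i : Fin n)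
    (k : Fin K) : ofBinary (I.alteration ω) i k ≤ if ω i = some k then 1 else 0 := by
  rw [ofBinary_alteration]
  by_cases h : I.Kept ω i k
  · simp [h, h.1]
  · simp [h]

theorem sum_mul_alteration_le_load (I : PIP n K m) (ω : Fin n → Option (Fin K)) (l : Fin m)
    (i : Fin n) : ∑ k, I.A l i k * ofBinary (I.alteration ω) i k ≤ I.load l i (ω i) := by
  refine (Finset.sum_le_sum fun k _ => mul_le_mul_right (I.ofBinary_alteration_le ω i k) _).trans ?_
  cases h : ω i <;> simp [load]

/-- If a surviving choice that uses the constraint is not big, then it and the others each take at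
most half of the capacity. -/
theorem isFeasible_alteration (I : PIP n K m) (ω : Fin n → Option (Fin K)) :
    I.IsFeasible (ofBinary (I.alteration ω)) := by
  classical
  refine ⟨fun i => (Finset.sum_le_sum fun k _ => I.ofBinary_alteration_le ω i k).trans ?_,
    fun l => ?_⟩
  · cases h : ω i <;> simp
  by_cases hex : ∃ i k, I.Kept ω i k ∧ I.A l i k ≠ 0
  swap
  · have h0 : ∀ i k, I.A l i k * ofBinary (I.alteration ω) i k = 0 := fun i k => by
      rw [ofBinary_alteration]
      by_cases hk : I.Kept ω i k
      · simp only [hk, if_true, mul_one]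
        by_contra hne
        exact hex ⟨i, k, hk, hne⟩
      · simp [hk]
    simp [h0]
  by_cases hsmall : ∃ i k, I.Kept ω i k ∧ I.A l i k ≠ 0 ∧ ¬ I.IsBig l i k
  · obtain ⟨i, k, hk, hA, hb⟩ := hsmall
    have h1 := (hk.2.2 l hA).2 hb
    have h2 : 2 * I.load l i (ω i) ≤ I.c l := by
      rw [hk.1]; exact not_lt.1 hb
    calc ∑ i, ∑ k, I.A l i k * ofBinary (I.alteration ω) i k ≤ ∑ i, I.load l i (ω i) :=
          Finset.sum_le_sum fun i _ => I.sum_mul_alteration_le_load ω l i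
      _ = I.load l i (ω i) + ∑ j ∈ Finset.univ.erase i, I.load l j (ω j) :=
          (Finset.add_sum_erase _ _ (Finset.mem_univ i)).symm
      _ ≤ I.c l := by
          rw [← NNReal.coe_le_coe] at *
          push_cast at *
          linarith
  · -- Every survivor that uses the constraint is big, so there is only one, and it fits.
    push Not at hsmall
    obtain ⟨i, k, hk, hA⟩ := hex
    have hbig := hsmall i k hk hA
    rw [Finset.sum_eq_single i]
    · refine (I.sum_mul_alteration_le_load ω l i).trans ?_
      rw [hk.1]; exact hk.2.1 l
    · intro j _ hj
      refine Finset.sum_eq_zero fun k' _ => ?_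
      rw [ofBinary_alteration]
      by_cases hk' : I.Kept ω j k'
      · simp only [hk', if_true, mul_one]
        by_contra hne
        exact (hk.2.2 l hA).1 hbig j hj k' hk'.1 (hsmall j k' hk' hne)
      · simp [hk']
    · simp

/-- The outcome made of the surviving choices. -/
def alterationOutcome (I : PIP n K m) (ω : Fin n → Option (Fin K)) : I.Outcome :=
  ⟨I.alteration ω, I.isFeasible_alteration ω⟩

open Classical in
theorem alloc_alterationOutcome (I : PIP n K m) (ω : Fin n → Option (Fin K)) (i : Fin n)
    (k : Fin K) : (I.alterationOutcome ω).alloc i k = if I.Kept ω i k then 1 else 0 :=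
  I.ofBinary_alteration ω i k

/-- If the choice of a fitting option is dropped because of constraint `l`, then the other bidders
tentatively use at least half of the capacity of `l`. -/
theorem exists_conflict_of_not_kept (I : PIP n K m) (ω : Fin n → Option (Fin K)) {i : Fin n}
    {k : Fin K} (hω : ω i = some k) (hfit : I.Fits i k) (h : ¬ I.Kept ω i k) :
    ∃ l, I.A l i k ≠ 0 ∧ I.c l ≤ 2 * ∑ j ∈ Finset.univ.erase i, I.load l j (ω j) := by
  by_contra hcon
  push Not at hcon
  refine h ⟨hω, hfit, fun l hA => ⟨fun _ j hj k' hk' hbig => ?_, fun _ => (hcon l hA).le⟩⟩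
  have h1 : I.load l j (ω j) ≤ ∑ j ∈ Finset.univ.erase i, I.load l j (ω j) :=
    Finset.single_le_sum (f := fun j => I.load l j (ω j)) (fun _ _ => zero_le)
      (Finset.mem_erase.2 ⟨hj, Finset.mem_univ j⟩)
  rw [hk'] at h1
  exact absurd (hbig.trans_le (mul_le_mul_right h1 2)) (hcon l hA).not_gt

theorem card_support_column_le (I : PIP n K m) (i : Fin n) (k : Fin K)
    [DecidablePred fun l => I.A l i k ≠ 0] :
    (Finset.univ.filter fun l : Fin m => I.A l i k ≠ 0).card ≤ I.columnSparsity := by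
  unfold columnSparsity
  refine le_trans ?_ (Finset.le_sup (Finset.mem_univ i))
  refine le_trans ?_ (Finset.le_sup (Finset.mem_univ k))
  exact le_of_eq (by congr)

/-- The distribution of the tentative choice of bidder `i`: option `k` with probability
`y i k / (4 * d)`, and no option otherwise. -/
def choiceProb (d : ℕ) (y : Fin n → Fin K → ℝ≥0) (i : Fin n) (o : Option (Fin K)) : ℝ≥0 :=
  o.elim (1 - ∑ k, y i k / (4 * d)) fun k => y i k / (4 * d)

theorem sum_choiceProb {I : PIP n K m} {d : ℕ} (hd : 1 ≤ d) {y : Fin n → Fin K → ℝ≥0}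
    (hy : I.IsFeasible y) (i : Fin n) : ∑ o, choiceProb d y i o = 1 := by
  rw [Fintype.sum_option]
  simp only [choiceProb, Option.elim_none, Option.elim_some]
  refine tsub_add_cancel_of_le ?_
  rw [← Finset.sum_div]
  refine (div_le_of_le_mul₀ (by simp) (by simp) ?_)
  have : (1 : ℝ≥0) ≤ d := by exact_mod_cast hd
  calc ∑ k, y i k ≤ 1 := hy.1 i
    _ ≤ 1 * (4 * d) := by
      rw [← NNReal.coe_le_coe] at *
      push_cast at *
      linarith

theorem continuous_prod_choiceProb (d : ℕ) (ω : Fin n → Option (Fin K)) :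
    Continuous fun y : Fin n → Fin K → ℝ≥0 => ∏ i, choiceProb d y i (ω i) := by
  refine continuous_finsetProd _ fun i _ => ?_
  cases h : ω i
  · simp only [choiceProb, Option.elim_none]
    fun_prop
  · simp only [choiceProb, Option.elim_some]
    fun_prop

theorem sum_choiceProb_mul_load (I : PIP n K m) (d : ℕ) (y : Fin n → Fin K → ℝ≥0) (l : Fin m)
    (j : Fin n) :
    ∑ o, choiceProb d y j o * I.load l j o = (∑ k, I.A l j k * y j k) / (4 * d) := by
  rw [Fintype.sum_option, Finset.sum_div]
  simp only [choiceProb, load, Option.elim_none, Option.elim_some, mul_zero, zero_add]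
  exact Finset.sum_congr rfl fun k _ => by ring

open Classical in
/-- Each variable survives with probability at least `y i k / (8 * d)`: it is chosen with
probability `y i k / (4 * d)`, and by Markov's inequality each of the at most `d` constraints that
it uses removes it with conditional probability at most `1 / (2 * d)`. -/
theorem div_le_prob_kept (I : PIP n K m) {d : ℕ} (hd : 1 ≤ d) (hI : I.columnSparsity ≤ d)
    (y : I.LPSolution) (i : Fin n) (k : Fin K) :
    y.1 i k / (8 * d) ≤
      ∑ ω : Fin n → Option (Fin K),
        (∏ i, choiceProb d y.1 i (ω i)) * (if I.Kept ω i k then 1 else 0) := by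
  by_cases hfit : I.Fits i k
  swap
  · simp [y.2.2 i k hfit]
  have hd0 : (d : ℝ≥0) ≠ 0 := by exact_mod_cast (by omega : d ≠ 0)
  have hp := sum_choiceProb hd y.2.1
  set P : (Fin n → Option (Fin K)) → ℝ≥0 := fun ω => ∏ i, choiceProb d y.1 i (ω i)
  set q := y.1 i k / (4 * d) with hq
  let chosen : Option (Fin K) → ℝ≥0 := fun o => if o = some k then 1 else 0
  let T := Finset.univ.filter fun l : Fin m => I.A l i k ≠ 0
  have hchosen : ∑ o, choiceProb d y.1 i o * chosen o = q := by
    simp [chosen, choiceProb, hq]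
  have hc : ∀ l ∈ T, I.c l ≠ 0 := fun l hl h0 =>
    (Finset.mem_filter.1 hl).2 (le_antisymm (h0 ▸ hfit l) zero_le)
  have hpt : ∀ ω, chosen (ω i) ≤ (if I.Kept ω i k then 1 else 0) +
      ∑ l ∈ T, ∑ j ∈ Finset.univ.erase i, 2 / I.c l * (chosen (ω i) * I.load l j (ω j)) := by
    intro ω
    by_cases hω : ω i = some k
    swap
    · simp [chosen, hω]
    by_cases hk : I.Kept ω i k
    · simp [chosen, hω, hk]
    obtain ⟨l, hA, hl⟩ := I.exists_conflict_of_not_kept ω hω hfit hk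
    have hlT : l ∈ T := Finset.mem_filter.2 ⟨Finset.mem_univ l, hA⟩
    simp only [chosen, hω, hk, if_true, if_false, zero_add, one_mul]
    refine le_trans ?_ (Finset.single_le_sum (f := fun l => ∑ j ∈ Finset.univ.erase i,
      2 / I.c l * I.load l j (ω j)) (fun _ _ => zero_le) hlT)
    rw [← Finset.mul_sum, div_mul_eq_mul_div, one_le_div₀ (pos_iff_ne_zero.2 (hc l hlT))]
    exact hl
  have hconf : ∀ l ∈ T, ∑ j ∈ Finset.univ.erase i,
      2 / I.c l * ∑ ω, P ω * (chosen (ω i) * I.load l j (ω j)) ≤ q / (2 * d) := by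
    intro l hl
    have h1 : ∀ j ∈ Finset.univ.erase i, 2 / I.c l * ∑ ω, P ω * (chosen (ω i) * I.load l j (ω j)) =
        q / (2 * d) / I.c l * ∑ k, I.A l j k * y.1 j k := fun j hj => by
      rw [sum_prod_mul_apply_mul_apply _ hp (Finset.ne_of_mem_erase hj).symm chosen (I.load l j),
        hchosen, sum_choiceProb_mul_load]
      have := hc l hl
      field_simp
      ring
    rw [Finset.sum_congr rfl h1, ← Finset.mul_sum, div_mul_eq_mul_div]
    refine div_le_of_le_mul₀ (by simp) (by simp) (mul_le_mul_right ?_ _)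
    exact (Finset.sum_le_sum_of_subset (Finset.erase_subset _ _)).trans (y.2.1.2 l)
  have hmain : q ≤ ∑ ω, P ω * (if I.Kept ω i k then 1 else 0) + q / 2 := by
    calc q = ∑ ω, P ω * chosen (ω i) := by rw [← hchosen, ← sum_prod_mul_apply _ hp]
      _ ≤ ∑ ω, P ω * ((if I.Kept ω i k then 1 else 0) + ∑ l ∈ T, ∑ j ∈ Finset.univ.erase i,
            2 / I.c l * (chosen (ω i) * I.load l j (ω j))) :=
          Finset.sum_le_sum fun ω _ => mul_le_mul_right (hpt ω) _
      _ = ∑ ω, P ω * (if I.Kept ω i k then 1 else 0) + ∑ l ∈ T, ∑ j ∈ Finset.univ.erase i,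
            2 / I.c l * ∑ ω, P ω * (chosen (ω i) * I.load l j (ω j)) := by
          simp only [mul_add, Finset.sum_add_distrib]
          congr 1
          simp only [Finset.mul_sum]
          rw [Finset.sum_comm]
          refine Finset.sum_congr rfl fun l _ => ?_
          rw [Finset.sum_comm]
          exact Finset.sum_congr rfl fun j _ => Finset.sum_congr rfl fun ω _ => by ring
      _ ≤ ∑ ω, P ω * (if I.Kept ω i k then 1 else 0) + ∑ l ∈ T, q / (2 * d) := by
          gcongr with l hl
          exact hconf l hl
      _ ≤ ∑ ω, P ω * (if I.Kept ω i k then 1 else 0) + q / 2 := by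
          gcongr
          rw [Finset.sum_const, nsmul_eq_mul]
          have hT : (T.card : ℝ≥0) ≤ d := by
            exact_mod_cast (I.card_support_column_le i k).trans hI
          calc (T.card : ℝ≥0) * (q / (2 * d)) ≤ d * (q / (2 * d)) := by gcongr
            _ = q / 2 := by field_simp
  have h8 : y.1 i k / (8 * d) = q / 2 := by rw [hq]; field_simp; ring
  rw [h8]
  have h2 : q / 2 + q / 2 = q := add_halves q
  exact le_of_add_le_add_right (a := q / 2) (by rw [h2]; exact hmain)

open Classical in
/-- The rounding scheme that draws the tentative choices independently from `choiceProb` and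
outputs the surviving ones. -/
def alterationRounding (I : PIP n K m) {d : ℕ} (hd : 1 ≤ d) : I.ObliviousRounding where
  round y := PMF.ofFintype
    (fun x => ((∑ ω : Fin n → Option (Fin K),
      if I.alterationOutcome ω = x then ∏ i, choiceProb d y.1 i (ω i) else 0 : ℝ≥0) : ℝ≥0∞)) (by
      rw [← ENNReal.ofNNReal_finsetSum, Finset.sum_comm]
      simp only [Finset.sum_ite_eq, Finset.mem_univ, if_true]
      rw [sum_prod_eq_one _ (sum_choiceProb hd y.2.1), ENNReal.coe_one])
  measurable_round x := by
    simp only [PMF.ofFintype_apply]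
    refine Measurable.coe_nnreal_ennreal (Finset.measurable_sum _ fun ω _ => ?_)
    split_ifs
    · exact (continuous_prod_choiceProb d ω).measurable.comp measurable_subtype_coe
    · exact measurable_const

theorem isApprox_alterationRounding (I : PIP n K m) {d : ℕ} (hd : 1 ≤ d)
    (hI : I.columnSparsity ≤ d) : (I.alterationRounding hd).IsApprox (8 * (d : ℝ≥0∞)) := by
  classical
  intro y w
  have hd0 : (8 * d : ℝ≥0) ≠ 0 := by
    exact_mod_cast (by omega : 8 * d ≠ 0)
  have h8 : (8 * (d : ℝ≥0∞)) = ((8 * d : ℝ≥0) : ℝ≥0∞) := by push_cast; rfl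
  rw [h8, ← ENNReal.coe_div hd0]
  simp only [alterationRounding, PMF.ofFintype_apply, ← ENNReal.coe_mul,
    ← ENNReal.ofNNReal_finsetSum, ENNReal.coe_le_coe]
  calc pipWelfare w y.1 / (8 * d) = ∑ i, ∑ k, w i k * (y.1 i k / (8 * d)) := by
        simp only [pipWelfare, pipValue, Finset.sum_div, mul_div_assoc]
    _ ≤ ∑ i, ∑ k, w i k * ∑ ω : Fin n → Option (Fin K),
          (∏ i, choiceProb d y.1 i (ω i)) * (if I.Kept ω i k then 1 else 0) := by
        gcongr with i _ k _
        exact I.div_le_prob_kept hd hI y i k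
    _ = ∑ ω : Fin n → Option (Fin K),
          (∏ i, choiceProb d y.1 i (ω i)) * pipWelfare w (I.alterationOutcome ω).alloc := by
        simp only [pipWelfare, pipValue, alloc_alterationOutcome, Finset.mul_sum]
        symm
        rw [Finset.sum_comm]
        refine Finset.sum_congr rfl fun i _ => ?_
        rw [Finset.sum_comm]
        exact Finset.sum_congr rfl fun k _ => Finset.sum_congr rfl fun ω _ => by ring
    _ = _ := by
        simp only [Finset.sum_mul]
        rw [Finset.sum_comm]
        simp [ite_mul]

end PIP

/-! ### Smoothness of the relaxation -/

theorem pipWelfare_update {n K : ℕ} (b : Fin n → PIPValuation K) (i : Fin n) (β : PIPValuation K)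
    (x : Fin n → Fin K → ℝ≥0) :
    pipWelfare (Function.update b i β) x =
      pipValue β (x i) + ∑ j ∈ Finset.univ.erase i, pipValue (b j) (x j) := by
  unfold pipWelfare
  rw [← Finset.add_sum_erase _ _ (Finset.mem_univ i), Function.update_self]
  congr 1
  exact Finset.sum_congr rfl fun j hj => by
    rw [Function.update_of_ne (Finset.ne_of_mem_erase hj)]

theorem pipWelfare_eq_add_sum_erase {n K : ℕ} (b : Fin n → PIPValuation K) (i : Fin n)
    (x : Fin n → Fin K → ℝ≥0) :
    pipWelfare b x =
      pipValue (b i) (x i) + ∑ j ∈ Finset.univ.erase i, pipValue (b j) (x j) :=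
  (Finset.add_sum_erase _ _ (Finset.mem_univ i)).symm

namespace PIP

variable {n K m : ℕ}

/-- The fraction of the capacity of constraint `l` that bidder `i` uses in `z`. If the capacity is
`0`, it is `0 / 0 = 0` for feasible `z`, so that `share_mul` and `sum_share_le_one` hold as well. -/
def share (I : PIP n K m) (z : Fin n → Fin K → ℝ≥0) (l : Fin m) (i : Fin n) : ℝ≥0 :=
  (∑ k, I.A l i k * z i k) / I.c l

theorem sum_share_le_one {I : PIP n K m} {z : Fin n → Fin K → ℝ≥0} (hz : I.IsFeasible z)
    (l : Fin m) : ∑ i, I.share z l i ≤ 1 := by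
  unfold share
  rw [← Finset.sum_div]
  exact div_le_one_of_le₀ (hz.2 l) zero_le

theorem share_le_one {I : PIP n K m} {z : Fin n → Fin K → ℝ≥0} (hz : I.IsFeasible z)
    (l : Fin m) (i : Fin n) : I.share z l i ≤ 1 :=
  (Finset.single_le_sum (f := fun i => I.share z l i) (fun _ _ => zero_le)
    (Finset.mem_univ i)).trans (sum_share_le_one hz l)

theorem share_mul {I : PIP n K m} {z : Fin n → Fin K → ℝ≥0} (hz : I.IsFeasible z)
    (l : Fin m) (i : Fin n) : I.share z l i * I.c l = ∑ k, I.A l i k * z i k := by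
  by_cases hc : I.c l = 0
  · have h : ∑ k, I.A l i k * z i k ≤ I.c l :=
      (Finset.single_le_sum (f := fun i => ∑ k, I.A l i k * z i k) (fun _ _ => zero_le)
        (Finset.mem_univ i)).trans (hz.2 l)
    rw [hc] at h ⊢
    rw [mul_zero, le_antisymm h zero_le]
  · exact div_mul_cancel₀ _ hc

open Classical in
/-- The total share that bidder `i` takes, in `z`, of the constraints used by the variable of
bidder `j` and option `k`. -/
def blocked (I : PIP n K m) (z : Fin n → Fin K → ℝ≥0) (i j : Fin n) (k : Fin K) : ℝ≥0 :=
  ∑ l ∈ Finset.univ.filter fun l : Fin m => I.A l j k ≠ 0, I.share z l i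

theorem sum_blocked_le {I : PIP n K m} {z : Fin n → Fin K → ℝ≥0} (hz : I.IsFeasible z) {d : ℕ}
    (hI : I.columnSparsity ≤ d) (j : Fin n) (k : Fin K) : ∑ i, I.blocked z i j k ≤ d := by
  classical
  unfold blocked
  rw [Finset.sum_comm]
  refine (Finset.sum_le_sum fun l _ => sum_share_le_one hz l).trans ?_
  rw [Finset.sum_const, nsmul_eq_mul, mul_one]
  exact_mod_cast (I.card_support_column_le j k).trans hI

/-- Give bidder `i` the assignment from `z`, and make room for it by scaling down the assignments
of the others in `y`. -/
def exchange (I : PIP n K m) (y z : Fin n → Fin K → ℝ≥0) (i : Fin n) : Fin n → Fin K → ℝ≥0 :=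
  fun j k => if j = i then z i k else y j k * (1 - I.blocked z i j k)

/-- Every other variable that uses constraint `l` is scaled by at most `1 - I.share z l i`, which
frees the capacity that bidder `i` needs. -/
theorem isRelaxed_exchange {I : PIP n K m} {y z : Fin n → Fin K → ℝ≥0} (hy : I.IsRelaxed y)
    (hz : I.IsRelaxed z) (i : Fin n) : I.IsRelaxed (I.exchange y z i) := by
  classical
  refine ⟨⟨fun j => ?_, fun l => ?_⟩, fun j k hjk => ?_⟩
  · by_cases hj : j = i
    · simpa [exchange, hj] using hz.1.1 i
    · simp only [exchange, hj, if_false]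
      exact (Finset.sum_le_sum fun k _ => mul_le_of_le_one_right' tsub_le_self).trans (hy.1.1 j)
  · rw [← Finset.add_sum_erase _ _ (Finset.mem_univ i)]
    have h1 : ∑ k, I.A l i k * I.exchange y z i i k = I.share z l i * I.c l := by
      simp [exchange, share_mul hz.1]
    have h2 : ∀ j ∈ Finset.univ.erase i, ∑ k, I.A l j k * I.exchange y z i j k ≤
        (1 - I.share z l i) * ∑ k, I.A l j k * y j k := by
      intro j hj
      rw [Finset.mul_sum]
      refine Finset.sum_le_sum fun k _ => ?_
      simp only [exchange, Finset.ne_of_mem_erase hj, if_false]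
      by_cases hA : I.A l j k = 0
      · simp [hA]
      have h3 : I.share z l i ≤ I.blocked z i j k :=
        Finset.single_le_sum (f := fun l => I.share z l i) (fun _ _ => zero_le)
          (Finset.mem_filter.2 ⟨Finset.mem_univ l, hA⟩)
      calc I.A l j k * (y j k * (1 - I.blocked z i j k))
          ≤ I.A l j k * (y j k * (1 - I.share z l i)) := by gcongr
        _ = (1 - I.share z l i) * (I.A l j k * y j k) := by ring
    rw [h1]
    calc I.share z l i * I.c l + ∑ j ∈ Finset.univ.erase i, ∑ k, I.A l j k * I.exchange y z i j k
        ≤ I.share z l i * I.c l + (1 - I.share z l i) * I.c l := by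
          gcongr
          refine (Finset.sum_le_sum h2).trans ?_
          rw [← Finset.mul_sum]
          gcongr
          exact (Finset.sum_le_sum_of_subset (Finset.erase_subset _ _)).trans (hy.1.2 l)
      _ = I.c l := by rw [← add_mul, add_tsub_cancel_of_le (share_le_one hz.1 l i), one_mul]
  · by_cases hj : j = i
    · subst hj; simp [exchange, hz.2 _ k hjk]
    · simp [exchange, hj, hy.2 j k hjk]

/-- A bound on the value that the other bidders lose when they make room for bidder `i`; the sum
includes `j = i`, so that summing over `i` compares it with the whole declared welfare. -/
def exchangeLoss (I : PIP n K m) (b : Fin n → PIPValuation K) (y z : Fin n → Fin K → ℝ≥0)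
    (i : Fin n) : ℝ≥0 := ∑ j, ∑ k, b j k * y j k * I.blocked z i j k

theorem sum_exchangeLoss_le {I : PIP n K m} {z : Fin n → Fin K → ℝ≥0} (hz : I.IsFeasible z)
    {d : ℕ} (hI : I.columnSparsity ≤ d) (b : Fin n → PIPValuation K) (y : Fin n → Fin K → ℝ≥0) :
    ∑ i, I.exchangeLoss b y z i ≤ d * pipWelfare b y := by
  unfold exchangeLoss pipWelfare pipValue
  rw [Finset.sum_comm, Finset.mul_sum]
  refine Finset.sum_le_sum fun j _ => ?_
  rw [Finset.sum_comm, Finset.mul_sum]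
  refine Finset.sum_le_sum fun k _ => ?_
  rw [← Finset.mul_sum, mul_comm]
  exact mul_le_mul_left (sum_blocked_le hz hI j k) _

theorem sum_erase_le_exchange_add_loss (I : PIP n K m) (b : Fin n → PIPValuation K)
    (y z : Fin n → Fin K → ℝ≥0) (i : Fin n) :
    ∑ j ∈ Finset.univ.erase i, pipValue (b j) (y j) ≤
      ∑ j ∈ Finset.univ.erase i, pipValue (b j) (I.exchange y z i j) +
        I.exchangeLoss b y z i := by
  have h : ∑ j ∈ Finset.univ.erase i, ∑ k, b j k * y j k * I.blocked z i j k ≤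
      I.exchangeLoss b y z i := Finset.sum_le_sum_of_subset (Finset.erase_subset _ _)
  refine le_trans ?_ (add_le_add_right h _)
  rw [← Finset.sum_add_distrib]
  refine Finset.sum_le_sum fun j hj => ?_
  unfold pipValue
  rw [← Finset.sum_add_distrib]
  refine Finset.sum_le_sum fun k _ => ?_
  simp only [exchange, Finset.ne_of_mem_erase hj, if_false]
  calc b j k * y j k = b j k * y j k * 1 := (mul_one _).symm
    _ ≤ b j k * y j k * ((1 - I.blocked z i j k) + I.blocked z i j k) := by
        gcongr
        exact le_tsub_add
    _ = _ := by ring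

/-- Smoothness of exact declared-welfare maximization over the relaxation: when every bidder `i` in
turn replaces the bid by `β i`, the deviators together obtain the declared value of any solution `z`
up to `d + 1` times the optimum for the original bids. In the deviation of bidder `i`, the solution
is at least as good as the exchange of bidder `i` into the optimum for `b`. -/
theorem LPSolver.smooth {I : PIP n K m} (S : I.LPSolver) {d : ℕ} (hI : I.columnSparsity ≤ d)
    (b β : Fin n → PIPValuation K) (z : I.LPSolution) :
    pipWelfare β z.1 ≤
      ∑ i, pipValue (β i) ((S.solve (Function.update b i (β i))).1 i) +
        (d + 1) * pipWelfare b (S.solve b).1 := by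
  set y := S.solve b
  have hi : ∀ i, pipValue (β i) (z.1 i) ≤
      pipValue (β i) ((S.solve (Function.update b i (β i))).1 i) +
        (pipValue (b i) (y.1 i) + I.exchangeLoss b y.1 z.1 i) := by
    intro i
    set y' := S.solve (Function.update b i (β i))
    have h1 := S.optimal (Function.update b i (β i)) ⟨_, isRelaxed_exchange y.2 z.2 i⟩
    rw [pipWelfare_update, pipWelfare_update] at h1
    have h2 : pipValue (β i) (I.exchange y.1 z.1 i i) = pipValue (β i) (z.1 i) := by
      simp [pipValue, exchange]
    -- Compared with what the others have in `y`, the deviation gains them at most the declared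
    -- value of bidder `i` in `y`, since `y` is optimal for `b`.
    have h3 : ∑ j ∈ Finset.univ.erase i, pipValue (b j) (y'.1 j) ≤ pipWelfare b y.1 :=
      (Finset.sum_le_sum_of_subset (Finset.erase_subset _ _)).trans (S.optimal b y')
    have h4 := I.sum_erase_le_exchange_add_loss b y.1 z.1 i
    rw [pipWelfare_eq_add_sum_erase b i] at h3
    rw [← NNReal.coe_le_coe] at *
    change pipValue (β i) (I.exchange y.1 z.1 i i) + _ ≤ _ at h1
    rw [h2] at h1
    rw [← NNReal.coe_le_coe] at h1
    push_cast at *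
    linarith
  calc pipWelfare β z.1 ≤ ∑ i, (pipValue (β i) ((S.solve (Function.update b i (β i))).1 i) +
        (pipValue (b i) (y.1 i) + I.exchangeLoss b y.1 z.1 i)) := Finset.sum_le_sum fun i _ => hi i
    _ = ∑ i, pipValue (β i) ((S.solve (Function.update b i (β i))).1 i) +
        (pipWelfare b y.1 + ∑ i, I.exchangeLoss b y.1 z.1 i) := by
      rw [Finset.sum_add_distrib, Finset.sum_add_distrib]; rfl
    _ ≤ _ := by
      gcongr
      calc pipWelfare b y.1 + ∑ i, I.exchangeLoss b y.1 z.1 i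
          ≤ pipWelfare b y.1 + d * pipWelfare b y.1 := by
            gcongr
            exact sum_exchangeLoss_le z.2.1 hI b y.1
        _ = (d + 1) * pipWelfare b y.1 := by ring

end PIP

/-! ### The Price of Anarchy -/

theorem pipValue_smul {K : ℕ} (c : ℝ≥0) (t : PIPValuation K) (y : Fin K → ℝ≥0) :
    pipValue (c • t) y = c * pipValue t y := by
  simp [pipValue, Finset.mul_sum, mul_assoc]

theorem pipWelfare_smul {n K : ℕ} (c : ℝ≥0) (v : Fin n → PIPValuation K)
    (x : Fin n → Fin K → ℝ≥0) : pipWelfare (c • v) x = c * pipWelfare v x := by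
  simp [pipWelfare, pipValue_smul, Finset.mul_sum]

theorem measurable_half_smul {K : ℕ} :
    Measurable fun t : PIPValuation K => (2⁻¹ : ℝ≥0) • t := by
  refine measurable_pi_lambda _ fun k => ?_
  exact (measurable_pi_apply k).const_mul _

namespace PIP

variable {n K m : ℕ} {I : PIP n K m}

theorem measurable_opt (I : PIP n K m) : Measurable I.opt := by
  unfold opt
  refine (Continuous.finset_sup_apply fun x _ => ?_).measurable
  unfold pipWelfare pipValue
  fun_prop

namespace PayYourBid

/-- The expected value, over the randomness of the mechanism, of a bidder `i` with valuation `t`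
for the outcome under the bids `b`. The expected payment is the case `t = b i`. -/
def expValue (M : I.PayYourBid) (i : Fin n) (b : Fin n → PIPValuation K) (t : PIPValuation K) :
    ℝ≥0∞ := ∑ x, M.outcome b x * (pipValue t (x.alloc i) : ℝ≥0∞)

theorem welfare_eq_sum_expValue (M : I.PayYourBid) (v b : Fin n → PIPValuation K) :
    M.welfare v b = ∑ i, M.expValue i b (v i) := by
  unfold welfare expValue pipWelfare
  rw [Finset.sum_comm]
  exact Finset.sum_congr rfl fun x _ => by rw [ENNReal.ofNNReal_finsetSum, Finset.mul_sum]

theorem expValue_smul (M : I.PayYourBid) (i : Fin n) (b : Fin n → PIPValuation K) (c : ℝ≥0)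
    (t : PIPValuation K) : M.expValue i b (c • t) = c * M.expValue i b t := by
  simp only [expValue, pipValue_smul, ENNReal.coe_mul, Finset.mul_sum]
  exact Finset.sum_congr rfl fun x _ => by ring

theorem expValue_le (M : I.PayYourBid) (i : Fin n) (b : Fin n → PIPValuation K)
    (t : PIPValuation K) : M.expValue i b t ≤ ((∑ k, t k : ℝ≥0) : ℝ≥0∞) := by
  have hx : ∀ x : I.Outcome, pipValue t (x.alloc i) ≤ ∑ k, t k := fun x =>
    Finset.sum_le_sum fun k _ => mul_le_of_le_one_right' <|
      (Finset.single_le_sum (f := fun k => x.alloc i k) (fun _ _ => zero_le)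
        (Finset.mem_univ k)).trans (x.2.1 i)
  calc M.expValue i b t ≤ ∑ x, M.outcome b x * ((∑ k, t k : ℝ≥0) : ℝ≥0∞) := by
        unfold expValue
        gcongr with x
        exact hx x
    _ = _ := by
        rw [← Finset.sum_mul, ← tsum_fintype (L := .unconditional _), (M.outcome b).tsum_coe,
          one_mul]

theorem expValue_ne_top (M : I.PayYourBid) (i : Fin n) (b : Fin n → PIPValuation K)
    (t : PIPValuation K) : M.expValue i b t ≠ ∞ :=
  ((M.expValue_le i b t).trans_lt ENNReal.coe_lt_top).ne

theorem measurable_expValue (M : I.PayYourBid) (i : Fin n) :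
    Measurable fun p : (Fin n → PIPValuation K) × PIPValuation K => M.expValue i p.1 p.2 := by
  unfold expValue pipValue
  refine Finset.measurable_sum _ fun x _ => ?_
  exact ((M.measurable_outcome x).comp measurable_fst).mul
    (Measurable.coe_nnreal_ennreal (by fun_prop))

theorem measurable_expValue_comp {Z : Type*} [MeasurableSpace Z] (M : I.PayYourBid) (i : Fin n)
    {b : Z → Fin n → PIPValuation K} (hb : Measurable b) {t : Z → PIPValuation K}
    (ht : Measurable t) : Measurable fun z => M.expValue i (b z) (t z) :=
  (M.measurable_expValue i).comp (hb.prodMk ht)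

theorem measurable_expValue_update_comp {Z : Type*} [MeasurableSpace Z] (M : I.PayYourBid)
    (i : Fin n) {b : Z → Fin n → PIPValuation K} (hb : Measurable b) {t : Z → PIPValuation K}
    (ht : Measurable t) : Measurable fun z => M.expValue i (Function.update (b z) i
      ((2⁻¹ : ℝ≥0) • t z)) ((2⁻¹ : ℝ≥0) • t z) := by
  have hhalf : Measurable fun z => (2⁻¹ : ℝ≥0) • t z := measurable_half_smul.comp ht
  have hupd : Measurable fun z => Function.update (b z) i ((2⁻¹ : ℝ≥0) • t z) :=
    (measurable_update' (a := i)).comp (hb.prodMk hhalf)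
  exact M.measurable_expValue_comp i hupd hhalf

theorem utility_eq (M : I.PayYourBid) (i : Fin n) (b : Fin n → PIPValuation K)
    (t : PIPValuation K) :
    M.utility i b t = (M.expValue i b t).toReal - (M.expValue i b (b i)).toReal := by
  have h : ∀ t, (M.expValue i b t).toReal =
      ∑ x, (M.outcome b x).toReal * (pipValue t (x.alloc i) : ℝ) := fun t => by
    unfold expValue
    rw [ENNReal.toReal_sum fun x _ => ENNReal.mul_ne_top (PMF.apply_ne_top _ _)
      ENNReal.coe_ne_top]
    simp
  rw [h, h, ← Finset.sum_sub_distrib]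
  exact Finset.sum_congr rfl fun x _ => by rw [payment]; ring

/-- If bidding half of the valuation `t` does not increase the expected utility, then what this
deviation yields (half of the value obtained, which is the expected payment as well) plus the
expected payment in equilibrium is at most the expected value in equilibrium. -/
theorem lintegral_half_deviation_le {Z : Type*} [MeasurableSpace Z] {μ : Measure Z}
    [IsProbabilityMeasure μ] (M : I.PayYourBid) (i : Fin n) {b : Z → Fin n → PIPValuation K}
    (hb : Measurable b) (t : PIPValuation K)
    (hint : Integrable (fun z => M.utility i (b z) t) μ)
    (hdev : ∫ z, M.utility i (Function.update (b z) i ((2⁻¹ : ℝ≥0) • t)) t ∂μ ≤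
      ∫ z, M.utility i (b z) t ∂μ) :
    ∫⁻ z, M.expValue i (Function.update (b z) i ((2⁻¹ : ℝ≥0) • t)) ((2⁻¹ : ℝ≥0) • t) ∂μ +
        ∫⁻ z, M.expValue i (b z) (b z i) ∂μ ≤
      ∫⁻ z, M.expValue i (b z) t ∂μ := by
  have hlin : ∀ e : Z → ℝ≥0∞, (∀ z, e z ≠ ∞) → Integrable (fun z => (e z).toReal) μ →
      ∫⁻ z, e z ∂μ = ENNReal.ofReal (∫ z, (e z).toReal ∂μ) := fun e he hi => by
    rw [ofReal_integral_eq_lintegral_ofReal hi (ae_of_all _ fun z => ENNReal.toReal_nonneg)]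
    exact lintegral_congr fun z => (ENNReal.ofReal_toReal (he z)).symm
  have hbdd : ∀ (b' : Z → Fin n → PIPValuation K) (t' : PIPValuation K), Measurable b' →
      Integrable (fun z => (M.expValue i (b' z) t').toReal) μ := fun b' t' hb' => by
    refine Integrable.of_bound (C := ((∑ k, t' k : ℝ≥0) : ℝ)) ?_ (ae_of_all _ fun z => ?_)
    · exact ((M.measurable_expValue i).comp
        (hb'.prodMk measurable_const)).ennreal_toReal.aestronglyMeasurable
    · rw [Real.norm_of_nonneg ENNReal.toReal_nonneg]
      exact ENNReal.toReal_mono ENNReal.coe_ne_top (M.expValue_le i _ _)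
  have hupd : Measurable fun z => Function.update (b z) i ((2⁻¹ : ℝ≥0) • t) :=
    (measurable_update' (a := i)).comp (hb.prodMk measurable_const)
  have h1 := hbdd _ ((2⁻¹ : ℝ≥0) • t) hupd
  have h3 := hbdd b t hb
  -- The payment is the bounded value obtained minus the integrable utility.
  have h2 : Integrable (fun z => (M.expValue i (b z) (b z i)).toReal) μ := by
    refine (h3.sub hint).congr (ae_of_all _ fun z => ?_)
    simp [utility_eq]
  rw [hlin _ (fun z => M.expValue_ne_top _ _ _) h1, hlin _ (fun z => M.expValue_ne_top _ _ _) h2,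
    hlin _ (fun z => M.expValue_ne_top _ _ _) h3,
    ← ENNReal.ofReal_add (integral_nonneg fun z => ENNReal.toReal_nonneg)
      (integral_nonneg fun z => ENNReal.toReal_nonneg)]
  refine ENNReal.ofReal_le_ofReal ?_
  have hl : ∀ z, M.utility i (Function.update (b z) i ((2⁻¹ : ℝ≥0) • t)) t =
      (M.expValue i (Function.update (b z) i ((2⁻¹ : ℝ≥0) • t)) ((2⁻¹ : ℝ≥0) • t)).toReal :=
    fun z => by
      rw [utility_eq, Function.update_self, expValue_smul, ENNReal.toReal_mul]
      simp only [ENNReal.coe_toReal]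
      push_cast
      ring
  simp only [hl] at hdev
  simp only [utility_eq] at hdev
  rw [integral_sub h3 h2] at hdev
  linarith

/-- The mechanism is smooth: the rounding loses a factor `α` in the smoothness of the relaxation,
both on the values of the deviators and on the payments. -/
theorem opt_le_of_isApprox (S : I.LPSolver) {R : I.ObliviousRounding} {α : ℝ≥0∞}
    (hR : R.IsApprox α) (hα0 : α ≠ 0) (hα : α ≠ ∞) {d : ℕ} (hI : I.columnSparsity ≤ d)
    (v b : Fin n → PIPValuation K) :
    (I.opt v : ℝ≥0∞) ≤ 2 * α *
      (∑ i, (relaxAndRound S R).expValue i (Function.update b i ((2⁻¹ : ℝ≥0) • v i))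
          ((2⁻¹ : ℝ≥0) • v i) +
        (d + 1) * ∑ i, (relaxAndRound S R).expValue i b (b i)) := by
  set M := relaxAndRound S R
  -- Obliviousness is used here: the objective that counts only bidder `i` is also approximated.
  have hval : ∀ (b : Fin n → PIPValuation K) (i : Fin n) (t : PIPValuation K),
      (pipValue t ((S.solve b).1 i) : ℝ≥0∞) ≤ α * M.expValue i b t := by
    intro b i t
    have hs : ∀ x, pipWelfare (Function.update (0 : Fin n → PIPValuation K) i t) x =
        pipValue t (x i) := fun x => by
      rw [pipWelfare_update]; simp [pipValue]
    have h := hR (S.solve b) (Function.update 0 i t)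
    simp only [hs] at h
    rw [mul_comm]
    exact (ENNReal.div_le_iff hα0 hα).1 h
  have hpay : (pipWelfare b (S.solve b).1 : ℝ≥0∞) ≤ α * ∑ i, M.expValue i b (b i) := by
    unfold pipWelfare
    rw [ENNReal.ofNNReal_finsetSum, Finset.mul_sum]
    exact Finset.sum_le_sum fun i _ => hval b i (b i)
  unfold opt
  refine Finset.sup_induction (p := fun a : ℝ≥0 => (a : ℝ≥0∞) ≤ _) (by simp) (fun a ha a' ha' => ?_)
    fun x _ => ?_
  · rcases le_total a a' with h | h
    · rwa [sup_of_le_right h]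
    · rwa [sup_of_le_left h]
  have hx := S.smooth hI b ((2⁻¹ : ℝ≥0) • v) ⟨x.alloc, isRelaxed_alloc x⟩
  have hx' : pipWelfare v x.alloc = 2 * pipWelfare ((2⁻¹ : ℝ≥0) • v) x.alloc := by
    rw [pipWelfare_smul, ← mul_assoc]; simp
  rw [hx', ENNReal.coe_mul, mul_assoc 2 α]
  refine mul_le_mul' (by simp) ((ENNReal.coe_le_coe.2 hx).trans ?_)
  rw [ENNReal.coe_add, ENNReal.coe_mul, ENNReal.ofNNReal_finsetSum, mul_add, Finset.mul_sum]
  refine add_le_add (Finset.sum_le_sum fun i _ => hval _ i _) ?_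
  calc ((d + 1 : ℝ≥0) : ℝ≥0∞) * (pipWelfare b (S.solve b).1 : ℝ≥0∞)
      ≤ (d + 1) * (α * ∑ i, M.expValue i b (b i)) := by
        push_cast
        gcongr
    _ = α * ((d + 1) * ∑ i, M.expValue i b (b i)) := by ring

/-- If values and bids are random and no bidder gains in expectation by bidding half of the value,
the expected optimum is at most `2 * α * (d + 1)` times the expected welfare. -/
theorem lintegral_opt_le {Z : Type*} [MeasurableSpace Z] {μ : Measure Z} (S : I.LPSolver)
    {R : I.ObliviousRounding} {α : ℝ≥0∞} (hR : R.IsApprox α) (hα0 : α ≠ 0) (hα : α ≠ ∞) {d : ℕ}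
    (hI : I.columnSparsity ≤ d) {v b : Z → Fin n → PIPValuation K} (hv : Measurable v)
    (hb : Measurable b)
    (h : ∀ i, ∫⁻ z, (relaxAndRound S R).expValue i
          (Function.update (b z) i ((2⁻¹ : ℝ≥0) • v z i)) ((2⁻¹ : ℝ≥0) • v z i) ∂μ +
        ∫⁻ z, (relaxAndRound S R).expValue i (b z) (b z i) ∂μ ≤
      ∫⁻ z, (relaxAndRound S R).expValue i (b z) (v z i) ∂μ) :
    ∫⁻ z, (I.opt (v z) : ℝ≥0∞) ∂μ ≤
      2 * α * (d + 1) * ∫⁻ z, (relaxAndRound S R).welfare (v z) (b z) ∂μ := by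
  set M := relaxAndRound S R
  have hvi : ∀ i, Measurable fun z => v z i := fun i => (measurable_pi_apply i).comp hv
  have hbi : ∀ i, Measurable fun z => b z i := fun i => (measurable_pi_apply i).comp hb
  have m1 := fun i => M.measurable_expValue_update_comp i hb (hvi i)
  have m2 := fun i => M.measurable_expValue_comp i hb (hbi i)
  have m3 := fun i => M.measurable_expValue_comp i hb (hvi i)
  have m1s := Finset.measurable_sum Finset.univ fun i _ => m1 i
  have m2s := Finset.measurable_sum Finset.univ fun i _ => m2 i
  simp only [welfare_eq_sum_expValue]
  rw [lintegral_finsetSum _ fun i _ => m3 i]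
  have m12 : Measurable fun z => ∑ i, M.expValue i (Function.update (b z) i
      ((2⁻¹ : ℝ≥0) • v z i)) ((2⁻¹ : ℝ≥0) • v z i) +
        ((d : ℝ≥0∞) + 1) * ∑ i, M.expValue i (b z) (b z i) := m1s.add (m2s.const_mul _)
  have hpt : ∀ z, (I.opt (v z) : ℝ≥0∞) ≤ 2 * α * (∑ i, M.expValue i (Function.update (b z) i
      ((2⁻¹ : ℝ≥0) • v z i)) ((2⁻¹ : ℝ≥0) • v z i) +
        (d + 1) * ∑ i, M.expValue i (b z) (b z i)) := fun z =>
    opt_le_of_isApprox S hR hα0 hα hI (v z) (b z)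
  refine (lintegral_mono hpt).trans ?_
  rw [lintegral_const_mul _ m12, lintegral_add_left m1s,
    lintegral_const_mul _ m2s, lintegral_finsetSum _ fun i _ => m1 i,
    lintegral_finsetSum _ fun i _ => m2 i, mul_assoc (2 * α)]
  refine mul_le_mul_right ?_ _
  have hsum := Finset.sum_le_sum fun i (_ : i ∈ Finset.univ) => h i
  rw [Finset.sum_add_distrib] at hsum
  -- The payments are counted `d + 1` times: once as part of `hsum`, `d` times as at most the
  -- welfare.
  refine le_trans ?_ (mul_le_mul_right hsum _)
  rw [mul_add]
  refine add_le_add_left ?_ _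
  exact le_mul_of_one_le_left' (le_add_self)

theorem priceOfAnarchy_le (S : I.LPSolver) {R : I.ObliviousRounding} {α : ℝ≥0∞}
    (hR : R.IsApprox α) (hα0 : α ≠ 0) (hα : α ≠ ∞) {d : ℕ} (hI : I.columnSparsity ≤ d) :
    (relaxAndRound S R).priceOfAnarchy ≤ 2 * α * (d + 1) := by
  refine iSup_le fun v => iSup_le fun σ => iSup_le fun hσ => ENNReal.div_le_of_le_mul ?_
  have := hσ.isProbabilityMeasure
  have h := lintegral_opt_le (μ := Measure.pi σ) S hR hα0 hα hI (v := fun _ => v) (b := id)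
    measurable_const measurable_id fun i =>
      lintegral_half_deviation_le _ i measurable_id (v i) (hσ.integrable i)
        (hσ.no_deviation i _)
  simpa using! h

/-- Disintegration of the joint law with respect to the valuation of bidder `i`. -/
theorem lintegral_jointLaw (D : Fin n → Measure (PIPValuation K))
    (s : Fin n → Kernel (PIPValuation K) (PIPValuation K)) [∀ i, IsProbabilityMeasure (D i)]
    [∀ i, IsMarkovKernel (s i)] (i : Fin n)
    {H : PIPValuation K → (Fin n → PIPValuation K × PIPValuation K) → ℝ≥0∞}
    (hH : Measurable (Function.uncurry H)) :
    ∫⁻ z, H (z i).1 z ∂jointLaw D s =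
      ∫⁻ t, ∫⁻ z, H t z ∂jointLaw (Function.update D i (Measure.dirac t)) s ∂D i := by
  let x₀ : Fin n → PIPValuation K × PIPValuation K := 0
  have hstep : ∀ D' : Fin n → Measure (PIPValuation K), (∀ j, IsProbabilityMeasure (D' j)) →
      ∀ F : (Fin n → PIPValuation K × PIPValuation K) → ℝ≥0∞, Measurable F →
      ∫⁻ z, F z ∂jointLaw D' s = ∫⁻ t, ∫⁻ c, lmarginal (fun j => D' j ⊗ₘ s j)
        (Finset.univ.erase i) F (Function.update x₀ i (t, c)) ∂s i t ∂D' i := by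
    intro D' hD' F hF
    unfold jointLaw
    rw [lintegral_eq_lmarginal_univ x₀, lmarginal_erase F hF (Finset.mem_univ i),
      Measure.lintegral_compProd]
    exact (hF.lmarginal _).comp (measurable_update x₀)
  have hcongr : ∀ t, lmarginal (fun j => Function.update D i (Measure.dirac t) j ⊗ₘ s j)
      (Finset.univ.erase i) = lmarginal (fun j => D j ⊗ₘ s j) (Finset.univ.erase i) := by
    intro t
    funext F x
    unfold lmarginal
    have : (fun j : (Finset.univ.erase i : Finset (Fin n)) =>
        Function.update D i (Measure.dirac t) j ⊗ₘ s j) =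
        fun j : (Finset.univ.erase i : Finset (Fin n)) => D j ⊗ₘ s j := by
      funext j
      rw [Function.update_of_ne (Finset.ne_of_mem_erase j.2)]
    rw [this]
  have hHt : ∀ t, Measurable (H t) := fun t => hH.comp measurable_prodMk_left
  have hHi : Measurable fun z : Fin n → PIPValuation K × PIPValuation K => H (z i).1 z :=
    hH.comp ((measurable_pi_apply i).fst.prodMk measurable_id)
  rw [hstep D inferInstance _ hHi]
  refine lintegral_congr fun t => ?_
  have hD' : ∀ j, IsProbabilityMeasure (Function.update D i (Measure.dirac t) j) := fun j => by
    by_cases hj : j = i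
    · subst hj; rw [Function.update_self]; infer_instance
    · rw [Function.update_of_ne hj]; infer_instance
  rw [hstep _ hD' _ (hHt t), hcongr, Function.update_self, lintegral_dirac']
  · refine lintegral_congr fun c => lintegral_congr fun y => ?_
    simp [Function.updateFinset]
  · have hm : Measurable fun p : PIPValuation K × PIPValuation K =>
        lmarginal (fun j => D j ⊗ₘ s j) (Finset.univ.erase i) (H t) (Function.update x₀ i p) :=
      ((hHt t).lmarginal _).comp (measurable_update x₀)
    exact hm.lintegral_kernel_prod_right'

theorem lintegral_pi_eq_lintegral_jointLaw (D : Fin n → Measure (PIPValuation K))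
    (s : Fin n → Kernel (PIPValuation K) (PIPValuation K)) [∀ i, IsProbabilityMeasure (D i)]
    [∀ i, IsMarkovKernel (s i)] {F : (Fin n → PIPValuation K) → ℝ≥0∞} (hF : Measurable F) :
    ∫⁻ v, F v ∂Measure.pi D = ∫⁻ z, F (fun j => (z j).1) ∂jointLaw D s := by
  have h : Measure.pi D = (jointLaw D s).map fun z j => (z j).1 := by
    unfold jointLaw
    have : ∀ i, SigmaFinite ((D i ⊗ₘ s i).map Prod.fst) := fun i => by
      change SigmaFinite (D i ⊗ₘ s i).fst
      infer_instance
    rw [Measure.pi_map_pi (f := fun _ => Prod.fst) fun i => measurable_fst.aemeasurable]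
    congr 1
    funext i
    exact (Measure.fst_compProd (D i) (s i)).symm
  rw [h, lintegral_map hF (by fun_prop)]

theorem bayesPriceOfAnarchy_le (S : I.LPSolver) {R : I.ObliviousRounding} {α : ℝ≥0∞}
    (hR : R.IsApprox α) (hα0 : α ≠ 0) (hα : α ≠ ∞) {d : ℕ} (hI : I.columnSparsity ≤ d) :
    (relaxAndRound S R).bayesPriceOfAnarchy ≤ 2 * α * (d + 1) := by
  refine iSup_le fun D => iSup_le fun s => iSup_le fun hs => ENNReal.div_le_of_le_mul ?_
  have := hs.isProbabilityMeasure
  have := hs.isMarkovKernel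
  rw [lintegral_pi_eq_lintegral_jointLaw D s I.measurable_opt.coe_nnreal_ennreal]
  have hbid : Measurable fun (z : Fin n → PIPValuation K × PIPValuation K) (j : Fin n) =>
      (z j).2 := by fun_prop
  refine lintegral_opt_le S hR hα0 hα hI (by fun_prop) hbid fun i => ?_
  set M := relaxAndRound S R
  have hbid' : Measurable fun p : PIPValuation K × (Fin n → PIPValuation K × PIPValuation K) =>
      fun j => (p.2 j).2 := hbid.comp measurable_snd
  rw [lintegral_jointLaw D s i (H := fun t z => M.expValue i
      (Function.update (fun j => (z j).2) i ((2⁻¹ : ℝ≥0) • t)) ((2⁻¹ : ℝ≥0) • t))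
      (M.measurable_expValue_update_comp i hbid' measurable_fst),
    lintegral_jointLaw D s i (H := fun _ z => M.expValue i (fun j => (z j).2) (z i).2)
      (M.measurable_expValue_comp i hbid' ((measurable_pi_apply i).comp hbid')),
    lintegral_jointLaw D s i (H := fun t z => M.expValue i (fun j => (z j).2) t)
      (M.measurable_expValue_comp i hbid' measurable_fst)]
  refine (le_lintegral_add _ _).trans (lintegral_mono_ae ?_)
  filter_upwards [hs.integrable i, hs.no_deviation i] with t hint hdev
  have hD' : ∀ j, IsProbabilityMeasure (Function.update D i (Measure.dirac t) j) := fun j => by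
    by_cases hj : j = i
    · subst hj; rw [Function.update_self]; infer_instance
    · rw [Function.update_of_ne hj]; infer_instance
  have : IsProbabilityMeasure (jointLaw (Function.update D i (Measure.dirac t)) s) := by
    unfold jointLaw; infer_instance
  exact lintegral_half_deviation_le M i hbid t hint (hdev _)

end PayYourBid

end PIP

end

theorem mainTheorem3 {n K m : ℕ} (I : PIP n K m) (d : ℕ) (hd : 1 ≤ d)
    (hI : I.columnSparsity ≤ d) :
    Nonempty I.LPSolver ∧
    ∃ R : I.ObliviousRounding, R.IsApprox (8 * (d : ENNReal)) ∧
      ∀ S : I.LPSolver,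
        ((PIP.relaxAndRound S R).priceOfAnarchy ≤ 16 * (d : ENNReal) * ((d : ENNReal) + 1) ∧
          (PIP.relaxAndRound S R).bayesPriceOfAnarchy ≤
            16 * (d : ENNReal) * ((d : ENNReal) + 1)) ∧
        (d = 1 →
          (PIP.relaxAndRound S R).priceOfAnarchy ≤ 32 ∧
          (PIP.relaxAndRound S R).bayesPriceOfAnarchy ≤ 32) := by
  have hR := I.isApprox_alterationRounding hd hI
  have h0 : (8 * (d : ℝ≥0∞)) ≠ 0 := by
    simp only [ne_eq, mul_eq_zero, OfNat.ofNat_ne_zero, Nat.cast_eq_zero, false_or]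
    omega
  have htop : (8 * (d : ℝ≥0∞)) ≠ ∞ := ENNReal.mul_ne_top (by simp) (by simp)
  have hbound : 2 * (8 * (d : ℝ≥0∞)) * (d + 1) = 16 * d * (d + 1) := by ring
  refine ⟨I.nonempty_lpSolver, I.alterationRounding hd, hR, fun S => ?_⟩
  have h1 := PIP.PayYourBid.priceOfAnarchy_le S hR h0 htop hI
  have h2 := PIP.PayYourBid.bayesPriceOfAnarchy_le S hR h0 htop hI
  rw [hbound] at h1 h2
  refine ⟨⟨h1, h2⟩, fun hd1 => ?_⟩
  subst hd1
  have h32 : 16 * ((1 : ℕ) : ℝ≥0∞) * (((1 : ℕ) : ℝ≥0∞) + 1) = 32 := by norm_num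
  exact ⟨h32 ▸ h1, h32 ▸ h2⟩
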